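/- Let $0<p<\infty$, and let $D$ be the open unit disc of $\mathbb{C}$. For $0<q<\infty$ and real $a<b$, let $H^q_{[a,b]}(D)$ be the set of holomorphic functions $f$ on $D$ with $\sup_{0<r<1}\int_a^b |f(re^{i\theta})|^q\,d\theta<+\infty$, and let $H^p=H^p_{[0,2\pi]}(D)$ be the usual Hardy space, with the metric $d_p(f,g)=\left(\sup_{0<r<1}\int_0^{2\pi}|f(re^{i\theta})-g(re^{i\theta})|^p\,d\theta\right)^{1/\max(1,p)}$. Then the set $$\{f\in H^p : f\notin H^q_{[a,b]}(D)\ \text{for all } p<q<\infty \text{ and all real } a<b\}$$ $$=\left\{f\in H^p : \sup_{0<r<1}\int_a^b |f(re^{i\theta})|^q\,d\theta=+\infty\ \text{for all } p<q<\infty \text{ and all real } a<b\right\}$$ is a dense $G_\delta$ subset of $H^p$. In particular it is non-empty. -/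

import Mathlib

open scoped ENNReal

noncomputable section

/-- `∫_a^b |f(r e^{iθ})|^q dθ`, with values in `[0, ∞]`. -/
def arcIntegral (f : ℂ → ℂ) (q a b r : ℝ) : ℝ≥0∞ :=
  ∫⁻ θ in Set.Icc a b, ‖f (r * Complex.exp (θ * Complex.I))‖ₑ ^ q

/-- `sup_{0 < r < 1} ∫_a^b |f(r e^{iθ})|^q dθ`, with values in `[0, ∞]`. -/
def arcSup (f : ℂ → ℂ) (q a b : ℝ) : ℝ≥0∞ :=
  ⨆ r ∈ Set.Ioo (0 : ℝ) 1, arcIntegral f q a b r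

/-- The restriction of `f` to the open unit disc belongs to the localized Hardy space
`H^q_{[a,b]}`. -/
def MemLocalizedHardy (q a b : ℝ) (f : ℂ → ℂ) : Prop :=
  DifferentiableOn ℂ f (Metric.ball 0 1) ∧ arcSup f q a b < ∞

/-- The Hardy space `H^p` of the open unit disc. A function on the disc is represented by its
extension by zero to the plane, so that distinct elements are distinct functions on the disc. -/
@[ext]
structure HardySpace (p : ℝ) where
  toFun : ℂ → ℂ
  differentiableOn : DifferentiableOn ℂ toFun (Metric.ball 0 1)
  arcSup_lt_top : arcSup toFun p 0 (2 * Real.pi) < ∞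
  eq_zero_of_notMem : ∀ z, z ∉ Metric.ball (0 : ℂ) 1 → toFun z = 0

/-- The usual `F`-norm of `H^p`: the norm `(sup_r ∫ |f|^p)^{1/p}` if `1 ≤ p`, and
`sup_r ∫ |f|^p` if `p < 1`. -/
def hardyGauge (p : ℝ) (f : ℂ → ℂ) : ℝ≥0∞ :=
  arcSup f p 0 (2 * Real.pi) ^ (max 1 p)⁻¹

theorem circle_mem_ball {r : ℝ} (hr : r ∈ Set.Ioo (0 : ℝ) 1) (θ : ℝ) :
    (r * Complex.exp (θ * Complex.I) : ℂ) ∈ Metric.ball (0 : ℂ) 1 := by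
  simp [Complex.norm_exp_ofReal_mul_I, abs_of_pos hr.1, hr.2]

theorem continuous_circle {f : ℂ → ℂ} (hf : ContinuousOn f (Metric.ball 0 1))
    {r : ℝ} (hr : r ∈ Set.Ioo (0 : ℝ) 1) :
    Continuous fun θ : ℝ => f (r * Complex.exp (θ * Complex.I)) :=
  hf.comp_continuous (by fun_prop) (circle_mem_ball hr)

theorem hardyGauge_add_le {p : ℝ} (hp : 0 < p) {f g : ℂ → ℂ}
    (hf : ContinuousOn f (Metric.ball 0 1)) (hg : ContinuousOn g (Metric.ball 0 1)) :
    hardyGauge p (f + g) ≤ hardyGauge p f + hardyGauge p g := by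
  have hm : 0 < max 1 p := by positivity
  unfold hardyGauge
  rw [ENNReal.rpow_inv_le_iff hm]
  refine iSup₂_le fun r hr => ?_
  rw [← ENNReal.rpow_inv_le_iff hm]
  have hF : arcIntegral f p 0 (2 * Real.pi) r ≤ arcSup f p 0 (2 * Real.pi) :=
    le_iSup₂ (f := fun r (_ : r ∈ Set.Ioo (0 : ℝ) 1) => arcIntegral f p 0 (2 * Real.pi) r) r hr
  have hG : arcIntegral g p 0 (2 * Real.pi) r ≤ arcSup g p 0 (2 * Real.pi) :=
    le_iSup₂ (f := fun r (_ : r ∈ Set.Ioo (0 : ℝ) 1) => arcIntegral g p 0 (2 * Real.pi) r) r hr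
  have hi : 0 ≤ (max 1 p)⁻¹ := by positivity
  refine le_trans ?_ (add_le_add (ENNReal.rpow_le_rpow hF hi) (ENNReal.rpow_le_rpow hG hi))
  have cf := (continuous_circle hf hr).enorm.measurable
  have cg := (continuous_circle hg hr).enorm.measurable
  have hadd : arcIntegral (f + g) p 0 (2 * Real.pi) r ≤
      ∫⁻ θ in Set.Icc 0 (2 * Real.pi), (‖f (r * Complex.exp (θ * Complex.I))‖ₑ
        + ‖g (r * Complex.exp (θ * Complex.I))‖ₑ) ^ p :=
    MeasureTheory.lintegral_mono fun θ => ENNReal.rpow_le_rpow (enorm_add_le _ _) hp.le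
  refine (ENNReal.rpow_le_rpow hadd hi).trans ?_
  rcases le_total 1 p with h | h
  · rw [max_eq_right h, ← one_div]
    exact ENNReal.lintegral_Lp_add_le cf.aemeasurable cg.aemeasurable h
  · rw [max_eq_left h, inv_one]
    simp only [ENNReal.rpow_one]
    unfold arcIntegral
    rw [← MeasureTheory.lintegral_add_left (cf.pow_const p)]
    exact MeasureTheory.lintegral_mono fun θ => ENNReal.rpow_add_le_add_rpow _ _ hp.le h

theorem hardyGauge_sub_comm (p : ℝ) (f g : ℂ → ℂ) :
    hardyGauge p (f - g) = hardyGauge p (g - f) := by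
  have h : ∀ z, ‖(f - g) z‖ₑ = ‖(g - f) z‖ₑ := fun z => by
    simp only [Pi.sub_apply]
    exact enorm_sub_rev _ _
  simp only [hardyGauge, arcSup, arcIntegral, h]

theorem eqOn_zero_of_hardyGauge_eq_zero {p : ℝ} (hp : 0 < p) {f : ℂ → ℂ}
    (hf : ContinuousOn f (Metric.ball 0 1)) (h : hardyGauge p f = 0) :
    ∀ z ∈ Metric.ball (0 : ℂ) 1, f z = 0 := by
  have hm : 0 < (max 1 p)⁻¹ := by positivity
  have h0 : arcSup f p 0 (2 * Real.pi) = 0 := by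
    simpa [hardyGauge, ENNReal.rpow_eq_zero_iff, hm, hm.not_gt] using h
  simp only [arcSup, ENNReal.iSup_eq_zero] at h0
  have key : ∀ z ∈ Metric.ball (0 : ℂ) 1, z ≠ 0 → f z = 0 := by
    intro z hz hz0
    have hr : ‖z‖ ∈ Set.Ioo (0 : ℝ) 1 := ⟨by simpa using hz0, by simpa using hz⟩
    have hc := continuous_circle hf hr
    have h1 := h0 _ hr
    rw [arcIntegral, MeasureTheory.lintegral_eq_zero_iff (hc.enorm.measurable.pow_const p)] at h1
    have h2 : (fun θ : ℝ => f (‖z‖ * Complex.exp (θ * Complex.I)))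
        =ᵐ[MeasureTheory.volume.restrict (Set.Icc 0 (2 * Real.pi))] fun _ => 0 := by
      filter_upwards [h1] with θ hθ
      simpa [ENNReal.rpow_eq_zero_iff, hp, hp.not_gt] using hθ
    have h3 := MeasureTheory.Measure.eqOn_Icc_of_ae_eq MeasureTheory.volume
      (by positivity) h2 hc.continuousOn continuousOn_const
    obtain ⟨t, ht, hzt⟩ : ∃ t ∈ Set.Icc (0 : ℝ) (2 * Real.pi),
        (‖z‖ * Complex.exp (t * Complex.I) : ℂ) = z := by
      rcases le_total 0 z.arg with ha | ha
      · exact ⟨z.arg, ⟨ha, by linarith [z.arg_le_pi, Real.pi_pos]⟩,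
          Complex.norm_mul_exp_arg_mul_I z⟩
      · refine ⟨z.arg + 2 * Real.pi, ⟨by linarith [z.neg_pi_lt_arg, Real.pi_pos], by linarith⟩, ?_⟩
        have : (((z.arg + 2 * Real.pi : ℝ) : ℂ) * Complex.I)
            = z.arg * Complex.I + 2 * Real.pi * Complex.I := by
          push_cast
          ring
        rw [this, Complex.exp_add, Complex.exp_two_pi_mul_I, mul_one]
        exact Complex.norm_mul_exp_arg_mul_I z
    have h4 := h3 ht
    simp only [hzt] at h4
    exact h4
  intro z hz
  by_cases hz0 : z = 0
  · subst hz0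
    have hc : ContinuousAt f 0 := hf.continuousAt (Metric.ball_mem_nhds _ one_pos)
    have l1 : Filter.Tendsto f (nhdsWithin 0 {0}ᶜ) (nhds (f 0)) :=
      hc.tendsto.mono_left nhdsWithin_le_nhds
    have l2 : Filter.Tendsto f (nhdsWithin 0 {0}ᶜ) (nhds 0) := by
      refine tendsto_const_nhds.congr' ?_
      filter_upwards [self_mem_nhdsWithin,
        nhdsWithin_le_nhds (Metric.ball_mem_nhds (0 : ℂ) one_pos)] with w hw hw'
      exact (key w hw' hw).symm
    exact tendsto_nhds_unique l1 l2
  · exact key z hz hz0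

theorem hardyGauge_zero {p : ℝ} (hp : 0 < p) : hardyGauge p 0 = 0 := by
  have hm : 0 < (max 1 p)⁻¹ := by positivity
  simp [hardyGauge, arcSup, arcIntegral, hp, ENNReal.zero_rpow_of_pos hm]

namespace HardySpace

variable {p : ℝ}

theorem hardyGauge_lt_top (f : HardySpace p) : hardyGauge p f.toFun < ∞ :=
  ENNReal.rpow_lt_top_of_nonneg (by positivity) f.arcSup_lt_top.ne

theorem hardyGauge_triangle (hp : 0 < p) {f g h : ℂ → ℂ}
    (hf : ContinuousOn f (Metric.ball 0 1)) (hg : ContinuousOn g (Metric.ball 0 1))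
    (hh : ContinuousOn h (Metric.ball 0 1)) :
    hardyGauge p (f - h) ≤ hardyGauge p (f - g) + hardyGauge p (g - h) := by
  simpa using hardyGauge_add_le hp (hf.sub hg) (hg.sub hh)

theorem hardyGauge_sub_ne_top (hp : 0 < p) (f g : HardySpace p) :
    hardyGauge p (f.toFun - g.toFun) ≠ ∞ := by
  have h := hardyGauge_triangle hp f.differentiableOn.continuousOn
    (continuousOn_const (c := (0 : ℂ))) g.differentiableOn.continuousOn
  have e1 : (f.toFun - fun _ => (0 : ℂ)) = f.toFun := by
    ext
    simp
  have e2 : hardyGauge p ((fun _ => (0 : ℂ)) - g.toFun) = hardyGauge p g.toFun := by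
    rw [hardyGauge_sub_comm]
    congr 1
    ext
    simp
  rw [e1, e2] at h
  exact (h.trans_lt (ENNReal.add_lt_top.2 ⟨f.hardyGauge_lt_top, g.hardyGauge_lt_top⟩)).ne

/-- The metric `d_p` of `H^p`: `d_p(f, g) = (sup_r ∫_0^{2π} |f - g|^p dθ)^{1 / max(1, p)}`. -/
instance instMetricSpace [hp : Fact (0 < p)] : MetricSpace (HardySpace p) where
  dist f g := (hardyGauge p (f.toFun - g.toFun)).toReal
  dist_self f := by simp [hardyGauge_zero hp.out]
  dist_comm f g := by rw [hardyGauge_sub_comm]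
  dist_triangle f g h := by
    rw [← ENNReal.toReal_add (hardyGauge_sub_ne_top hp.out f g) (hardyGauge_sub_ne_top hp.out g h)]
    exact ENNReal.toReal_mono (ENNReal.add_ne_top.2
      ⟨hardyGauge_sub_ne_top hp.out f g, hardyGauge_sub_ne_top hp.out g h⟩)
      (hardyGauge_triangle hp.out f.differentiableOn.continuousOn
        g.differentiableOn.continuousOn h.differentiableOn.continuousOn)
  eq_of_dist_eq_zero {f g} h := by
    have h0 : hardyGauge p (f.toFun - g.toFun) = 0 :=
      (ENNReal.toReal_eq_zero_iff _).1 h |>.resolve_right (hardyGauge_sub_ne_top hp.out f g)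
    have h1 := eqOn_zero_of_hardyGauge_eq_zero hp.out
      (f.differentiableOn.continuousOn.sub g.differentiableOn.continuousOn) h0
    ext1
    funext z
    by_cases hz : z ∈ Metric.ball (0 : ℂ) 1
    · exact sub_eq_zero.1 (h1 z hz)
    · rw [f.eq_zero_of_notMem z hz, g.eq_zero_of_notMem z hz]

/-- The functions of `H^p` that lie in no localized Hardy space `H^q_{[a,b]}` with
`p < q < ∞` and `a < b`. -/
def nowhereBetter (p : ℝ) : Set (HardySpace p) :=
  {f | ∀ q : ℝ, p < q → ∀ a b : ℝ, a < b → ¬ MemLocalizedHardy q a b f.toFun}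

end HardySpace

end

/-! If `f` has finite `q`-means on `[a,b]`, it has finite means for every smaller positive exponent
on every subarc. So the exponents `p + 1/(n+1)` and rational endpoints suffice, and the set is a
countable intersection (`nowhereBetter_eq_iInter`). Each condition is `G_δ`: by Fatou, the arc
integral on a circle of radius `r < 1` is lower semicontinuous on `H^p` (`isClosed_arcIntegral_le`).

Density needs only one member `f`, and no Baire argument: on a line `g + s f` each condition fails
for at most one real `s` (`subsingleton_addSMul_arcSup_lt_top`), so arbitrarily small good `s`
exist.

The member is `f = F^{1/p}` with `F = ∑ w_i (1 - e^{-it_i} z)^{-β_i}`, where the pairs `(t_i, β_i)`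
combine every rational `t` with exponents `β < 1` tending to `1`. Each term has modulus at most a
constant times its positive real part. The mean value property then bounds the `L^1` means of `F`,
and positivity excludes cancellation, so `|F|` dominates a multiple of each term. Hence `|f|^p =
|F|` has bounded means, while `|f|^q` has a non-integrable singularity at `t_i` once `β_i q / p ≥
1`. -/

/-! ### Comparison of arc means. -/

theorem arcIntegral_le_arcSup (f : ℂ → ℂ) (q a b : ℝ) {r : ℝ} (hr : r ∈ Set.Ioo (0 : ℝ) 1) :
    arcIntegral f q a b r ≤ arcSup f q a b :=
  le_iSup₂ (f := fun r (_ : r ∈ Set.Ioo (0 : ℝ) 1) => arcIntegral f q a b r) r hr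

theorem arcSup_mono_interval (f : ℂ → ℂ) (q : ℝ) {a a' b b' : ℝ} (ha : a ≤ a') (hb : b' ≤ b) :
    arcSup f q a' b' ≤ arcSup f q a b :=
  iSup₂_mono fun _ _ => MeasureTheory.lintegral_mono_set (Set.Icc_subset_Icc ha hb)

/-- Pointwise `x^q ≤ 1 + x^{q'}`, and the arc has finite length. -/
theorem arcSup_lt_top_of_exponent_le (f : ℂ → ℂ) {q q' : ℝ} (hq : 0 ≤ q) (hqq : q ≤ q') (a b : ℝ)
    (h : arcSup f q' a b < ∞) : arcSup f q a b < ∞ := by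
  refine lt_of_le_of_lt (b := ENNReal.ofReal (b - a) + arcSup f q' a b) ?_
    (ENNReal.add_lt_top.2 ⟨ENNReal.ofReal_lt_top, h⟩)
  refine iSup₂_le fun r hr => ?_
  refine le_trans ?_ (add_le_add le_rfl (arcIntegral_le_arcSup f q' a b hr))
  have hone : ENNReal.ofReal (b - a) = ∫⁻ _ in Set.Icc a b, (1 : ℝ≥0∞) := by simp
  rw [hone, arcIntegral, arcIntegral, ← MeasureTheory.lintegral_add_left measurable_const]
  refine MeasureTheory.lintegral_mono fun θ => ?_
  dsimp only
  set x := ‖f (r * Complex.exp (θ * Complex.I))‖ₑ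
  rcases le_total x 1 with hx | hx
  · exact (ENNReal.rpow_le_one hx hq).trans le_self_add
  · exact (ENNReal.rpow_le_rpow_of_exponent_le hx hqq).trans le_add_self

/-- A function dominated on the disc by two functions with finite arc means has finite
arc means. -/
theorem arcSup_lt_top_of_enorm_le {h u v : ℂ → ℂ} {q a b : ℝ} (hq : 0 ≤ q) {K : ℝ≥0∞}
    (hK : K ≠ ∞) (hu : ContinuousOn u (Metric.ball 0 1))
    (hle : ∀ z ∈ Metric.ball (0 : ℂ) 1, ‖h z‖ₑ ≤ K * (‖u z‖ₑ + ‖v z‖ₑ))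
    (fu : arcSup u q a b < ∞) (fv : arcSup v q a b < ∞) : arcSup h q a b < ∞ := by
  have hC : (K * 2) ^ q ≠ ∞ := ENNReal.rpow_ne_top_of_nonneg hq (by finiteness)
  refine lt_of_le_of_lt (b := (K * 2) ^ q * (arcSup u q a b + arcSup v q a b)) ?_
    (ENNReal.mul_lt_top hC.lt_top (ENNReal.add_lt_top.2 ⟨fu, fv⟩))
  refine iSup₂_le fun r hr => ?_
  have hI : arcIntegral h q a b r ≤
      (K * 2) ^ q * (arcIntegral u q a b r + arcIntegral v q a b r) := by
    unfold arcIntegral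
    rw [← MeasureTheory.lintegral_add_left
      ((continuous_circle hu hr).enorm.measurable.pow_const q),
      ← MeasureTheory.lintegral_const_mul' _ _ hC]
    refine MeasureTheory.lintegral_mono fun θ => ?_
    have h1 := hle _ (circle_mem_ball hr θ)
    dsimp only
    set x := ‖u (r * Complex.exp (θ * Complex.I))‖ₑ
    set y := ‖v (r * Complex.exp (θ * Complex.I))‖ₑ
    -- Passing through the maximum treats `q < 1` and `q ≥ 1` alike, at the cost of a factor `2^q`.
    have h2 : x + y ≤ 2 * max x y := by
      rw [two_mul]
      exact add_le_add (le_max_left _ _) (le_max_right _ _)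
    have h3 := h1.trans (mul_le_mul_right h2 K)
    rw [← mul_assoc] at h3
    refine (ENNReal.rpow_le_rpow h3 hq).trans ?_
    rw [ENNReal.mul_rpow_of_nonneg _ _ hq]
    gcongr
    rcases le_total x y with hxy | hxy
    · rw [max_eq_right hxy]
      exact le_add_self
    · rw [max_eq_left hxy]
      exact le_self_add
  refine hI.trans ?_
  gcongr
  · exact arcIntegral_le_arcSup u q a b hr
  · exact arcIntegral_le_arcSup v q a b hr

/-- A property of points of the circle that holds almost everywhere on one period holds almost
everywhere on the line. -/
theorem ae_circle_of_ae_Icc {P : ℂ → Prop}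
    (h : ∀ᵐ θ : ℝ ∂(MeasureTheory.volume.restrict (Set.Icc 0 (2 * Real.pi))),
      P (Complex.exp (θ * Complex.I))) :
    ∀ᵐ θ : ℝ, P (Complex.exp (θ * Complex.I)) := by
  rw [MeasureTheory.ae_restrict_iff' measurableSet_Icc] at h
  have hk : ∀ k : ℤ, ∀ᵐ θ : ℝ, θ + k * (2 * Real.pi) ∈ Set.Icc 0 (2 * Real.pi) →
      P (Complex.exp (θ * Complex.I)) := by
    intro k
    have h1 := (MeasureTheory.measurePreserving_add_right MeasureTheory.volume
      ((k : ℝ) * (2 * Real.pi))).quasiMeasurePreserving.ae h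
    filter_upwards [h1] with θ hθ hmem
    have h2 := hθ hmem
    have e : (((θ + k * (2 * Real.pi) : ℝ) : ℂ) * Complex.I)
        = θ * Complex.I + k * (2 * Real.pi * Complex.I) := by
      push_cast
      ring
    rwa [e, Complex.exp_add, Complex.exp_int_mul_two_pi_mul_I, mul_one] at h2
  filter_upwards [MeasureTheory.ae_all_iff.2 hk] with θ hθ
  have hp := Real.two_pi_pos
  refine hθ (-⌊θ / (2 * Real.pi)⌋) ⟨?_, ?_⟩
  · have := Int.floor_le (θ / (2 * Real.pi))
    rw [le_div_iff₀ hp] at this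
    push_cast
    linarith
  · have := (Int.lt_floor_add_one (θ / (2 * Real.pi))).le
    rw [div_le_iff₀ hp] at this
    push_cast
    linarith

/-! ### The `G_δ` property. -/

namespace HardySpace

variable {p : ℝ} [hp : Fact (0 < p)]

theorem tendsto_arcIntegral_sub {u : ℕ → HardySpace p} {f : HardySpace p}
    (h : Filter.Tendsto u Filter.atTop (nhds f)) {r : ℝ} (hr : r ∈ Set.Ioo (0 : ℝ) 1) :
    Filter.Tendsto (fun n => arcIntegral ((u n).toFun - f.toFun) p 0 (2 * Real.pi) r)
      Filter.atTop (nhds 0) := by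
  have hm : 0 < max 1 p := by positivity
  have h1 : Filter.Tendsto (fun n => hardyGauge p ((u n).toFun - f.toFun))
      Filter.atTop (nhds 0) := by
    have h2 := tendsto_iff_dist_tendsto_zero.1 h
    refine (ENNReal.tendsto_toReal_iff
      (fun n => hardyGauge_sub_ne_top hp.out (u n) f) ENNReal.zero_ne_top).1 ?_
    rwa [ENNReal.toReal_zero]
  have h3 := (ENNReal.continuous_rpow_const (y := max 1 p)).tendsto 0 |>.comp h1
  rw [ENNReal.zero_rpow_of_pos hm] at h3
  refine tendsto_of_tendsto_of_tendsto_of_le_of_le tendsto_const_nhds h3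
    (fun _ => zero_le) fun n => ?_
  simp only [Function.comp, hardyGauge]
  rw [ENNReal.rpow_inv_rpow hm.ne']
  exact arcIntegral_le_arcSup _ _ _ _ hr

/-- Convergence in `L^p` on the circle gives convergence in measure, for `p < 1` too. The conclusion
is on the whole line because arcs have arbitrary real endpoints. -/
theorem exists_subseq_tendsto_ae {u : ℕ → HardySpace p} {f : HardySpace p}
    (h : Filter.Tendsto u Filter.atTop (nhds f)) {r : ℝ} (hr : r ∈ Set.Ioo (0 : ℝ) 1) :
    ∃ ns : ℕ → ℕ, ∀ᵐ θ : ℝ,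
      Filter.Tendsto (fun k => (u (ns k)).toFun (r * Complex.exp (θ * Complex.I)))
        Filter.atTop (nhds (f.toFun (r * Complex.exp (θ * Complex.I)))) := by
  have hP0 : ENNReal.ofReal p ≠ 0 := by simpa using hp.out
  have cu : ∀ g : HardySpace p, Continuous fun θ : ℝ => g.toFun (r * Complex.exp (θ * Complex.I)) :=
    fun g => continuous_circle g.differentiableOn.continuousOn hr
  obtain ⟨ns, -, hns⟩ := (MeasureTheory.tendstoInMeasure_of_tendsto_eLpNorm
    (μ := MeasureTheory.volume.restrict (Set.Icc 0 (2 * Real.pi)))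
    (f := fun n (θ : ℝ) => (u n).toFun (r * Complex.exp (θ * Complex.I)))
    (g := fun θ : ℝ => f.toFun (r * Complex.exp (θ * Complex.I))) (l := Filter.atTop) hP0
    (fun n => (cu (u n)).aestronglyMeasurable) (cu f).aestronglyMeasurable (by
      have h1 := (ENNReal.continuous_rpow_const (y := 1 / p)).tendsto 0 |>.comp
        (tendsto_arcIntegral_sub h hr)
      rw [ENNReal.zero_rpow_of_pos (by simpa using hp.out)] at h1
      refine h1.congr fun n => ?_
      rw [MeasureTheory.eLpNorm_eq_lintegral_rpow_enorm_toReal hP0 ENNReal.ofReal_ne_top,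
        ENNReal.toReal_ofReal hp.out.le]
      rfl)).exists_seq_tendsto_ae
  exact ⟨ns, ae_circle_of_ae_Icc (P := fun w => Filter.Tendsto (fun k => (u (ns k)).toFun (r * w))
    Filter.atTop (nhds (f.toFun (r * w)))) hns⟩

/-- Fatou's lemma along an almost everywhere convergent subsequence. -/
theorem isClosed_arcIntegral_le {q : ℝ} (a b : ℝ) {r : ℝ} (hr : r ∈ Set.Ioo (0 : ℝ) 1)
    (c : ℝ≥0∞) : IsClosed {f : HardySpace p | arcIntegral f.toFun q a b r ≤ c} := by
  refine IsSeqClosed.isClosed fun u f hu h => ?_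
  obtain ⟨ns, hns⟩ := exists_subseq_tendsto_ae h hr
  have hm : ∀ k, Measurable fun θ : ℝ => ‖(u (ns k)).toFun (r * Complex.exp (θ * Complex.I))‖ₑ ^ q :=
    fun k => (continuous_circle (u (ns k)).differentiableOn.continuousOn
      hr).enorm.measurable.pow_const q
  calc arcIntegral f.toFun q a b r
      ≤ ∫⁻ θ in Set.Icc a b, Filter.liminf
        (fun k => ‖(u (ns k)).toFun (r * Complex.exp (θ * Complex.I))‖ₑ ^ q) Filter.atTop := by
        refine MeasureTheory.lintegral_mono_ae (MeasureTheory.ae_restrict_of_ae ?_)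
        filter_upwards [hns] with θ hθ
        have := ((ENNReal.continuous_rpow_const (y := q)).tendsto _).comp hθ.enorm
        exact this.liminf_eq.ge
    _ ≤ Filter.liminf (fun k => arcIntegral (u (ns k)).toFun q a b r) Filter.atTop :=
        MeasureTheory.lintegral_liminf_le hm
    _ ≤ c := Filter.liminf_le_of_le (by isBoundedDefault) fun d hd => by
        obtain ⟨k, hk⟩ := hd.exists
        exact hk.trans (hu (ns k))

theorem isGδ_arcSup_eq_top (q a b : ℝ) :
    IsGδ {f : HardySpace p | arcSup f.toFun q a b = ∞} := by
  have e : {f : HardySpace p | arcSup f.toFun q a b = ∞} =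
      ⋂ n : ℕ, {f : HardySpace p | (n : ℝ≥0∞) < arcSup f.toFun q a b} := by
    ext f
    simp only [Set.mem_ofPred_eq, Set.mem_iInter]
    refine ⟨fun h n => h ▸ ENNReal.natCast_lt_top n, fun h => ?_⟩
    exact ENNReal.eq_top_of_forall_nnreal_le fun x => by
      obtain ⟨n, hn⟩ := exists_nat_ge x
      exact le_trans (by exact_mod_cast hn) (h n).le
  rw [e]
  refine IsGδ.iInter_of_isOpen fun n => ?_
  have e2 : {f : HardySpace p | (n : ℝ≥0∞) < arcSup f.toFun q a b} =
      ⋃ r ∈ Set.Ioo (0 : ℝ) 1, {f : HardySpace p | arcIntegral f.toFun q a b r ≤ n}ᶜ := by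
    ext f
    simp [arcSup, lt_iSup_iff]
  rw [e2]
  exact isOpen_biUnion fun r hr => (isClosed_arcIntegral_le a b hr _).isOpen_compl

theorem notMem_localizedHardy_iff {p : ℝ} (f : HardySpace p) (q a b : ℝ) :
    ¬ MemLocalizedHardy q a b f.toFun ↔ arcSup f.toFun q a b = ∞ := by
  simp [MemLocalizedHardy, f.differentiableOn]

/-- The countably many exponents and arcs that suffice to test `nowhereBetter`. -/
theorem nowhereBetter_eq_iInter : nowhereBetter p =
    ⋂ i : ℕ × {x : ℚ × ℚ // x.1 < x.2},
      {f : HardySpace p | arcSup f.toFun (p + 1 / (i.1 + 1)) i.2.1.1 i.2.1.2 = ∞} := by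
  ext f
  simp only [nowhereBetter, notMem_localizedHardy_iff, Set.mem_ofPred_eq, Set.mem_iInter]
  constructor
  · rintro h ⟨n, x, hx⟩
    exact h _ (by simpa using by positivity) _ _ (by exact_mod_cast hx)
  · intro h q hq a b hab
    obtain ⟨n, hn⟩ := exists_nat_one_div_lt (sub_pos.2 hq)
    obtain ⟨a', ha, ha'⟩ := exists_rat_btwn hab
    obtain ⟨b', hb, hb'⟩ := exists_rat_btwn ha'
    by_contra hne
    -- Finite means for `q` on `[a, b]` pass to the smaller exponent `p + 1/(n+1) < q`, then to the
    -- rational subarc.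
    have h1 := arcSup_lt_top_of_exponent_le f.toFun (q := p + 1 / (n + 1)) (q' := q)
      (by have := hp.out; positivity) (by linarith) a b (lt_top_iff_ne_top.2 hne)
    have h2 := h (n, ⟨(a', b'), by exact_mod_cast hb⟩)
    exact (lt_of_le_of_lt (arcSup_mono_interval _ _ ha.le hb'.le) h1).ne h2

theorem isGδ_nowhereBetter : IsGδ (nowhereBetter p) := by
  rw [nowhereBetter_eq_iInter]
  exact IsGδ.iInter fun i => isGδ_arcSup_eq_top _ _ _

/-! ### Density from a single member. -/

/-- The element `g + s • f` of `H^p`. -/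
def addSMul (g f : HardySpace p) (s : ℝ) : HardySpace p where
  toFun := g.toFun + fun z => (s : ℂ) * f.toFun z
  differentiableOn := g.differentiableOn.add (f.differentiableOn.const_mul _)
  arcSup_lt_top := by
    refine arcSup_lt_top_of_enorm_le (K := 1 + ‖(s : ℂ)‖ₑ) hp.out.le (by finiteness)
      g.differentiableOn.continuousOn (fun z _ => ?_) g.arcSup_lt_top f.arcSup_lt_top
    refine (enorm_add_le _ _).trans ?_
    rw [enorm_mul, mul_add]
    gcongr
    · exact le_mul_of_one_le_left' le_self_add
    · exact le_add_self
  eq_zero_of_notMem z hz := by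
    simp [g.eq_zero_of_notMem z hz, f.eq_zero_of_notMem z hz]

theorem arcSup_const_mul (f : ℂ → ℂ) {q : ℝ} (hq : 0 < q) (a b s : ℝ) :
    arcSup (fun z => (s : ℂ) * f z) q a b = ‖s‖ₑ ^ q * arcSup f q a b := by
  simp only [arcSup, ENNReal.mul_iSup]
  refine iSup_congr fun r => iSup_congr fun _ => ?_
  simp only [arcIntegral, enorm_mul, ENNReal.mul_rpow_of_nonneg _ _ hq.le]
  rw [MeasureTheory.lintegral_const_mul' _ _ (ENNReal.rpow_ne_top_of_nonneg hq.le (by finiteness))]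
  simp [enorm]

theorem tendsto_addSMul (g f : HardySpace p) :
    Filter.Tendsto (addSMul g f) (nhds 0) (nhds g) := by
  rw [tendsto_iff_dist_tendsto_zero]
  have hm : 0 < (max 1 p)⁻¹ := by positivity
  have e : ∀ s, dist (addSMul g f s) g =
      ((‖s‖ₑ ^ p * arcSup f.toFun p 0 (2 * Real.pi)) ^ (max 1 p)⁻¹).toReal := fun s => by
    rw [← arcSup_const_mul f.toFun hp.out]
    change (hardyGauge p (g.toFun + (fun z => (s : ℂ) * f.toFun z) - g.toFun)).toReal = _
    rw [add_sub_cancel_left]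
    rfl
  simp only [e]
  have h1 : Filter.Tendsto (fun s : ℝ => ‖s‖ₑ ^ p) (nhds 0) (nhds 0) := by
    have : Continuous fun s : ℝ => ‖s‖ₑ ^ p := ENNReal.continuous_rpow_const.comp continuous_enorm
    simpa [hp.out] using this.tendsto 0
  have h2 := ENNReal.Tendsto.mul_const h1 (Or.inr f.arcSup_lt_top.ne)
  rw [zero_mul] at h2
  have h3 := ((ENNReal.continuous_rpow_const (y := (max 1 p)⁻¹)).tendsto 0).comp h2
  rw [ENNReal.zero_rpow_of_pos hm] at h3
  have h4 := (ENNReal.tendsto_toReal ENNReal.zero_ne_top).comp h3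
  rwa [ENNReal.toReal_zero] at h4

/-- Two distinct parameters with finite means would give `f`, a multiple of the difference of the
two functions, finite means. -/
theorem subsingleton_addSMul_arcSup_lt_top (g f : HardySpace p) {q a b : ℝ} (hq : 0 ≤ q)
    (hf : arcSup f.toFun q a b = ∞) :
    {s : ℝ | arcSup (addSMul g f s).toFun q a b ≠ ∞}.Subsingleton := by
  intro s hs t ht
  by_contra hst
  have hc : ((s : ℂ) - t) ≠ 0 := by exact_mod_cast sub_ne_zero.2 hst
  refine (arcSup_lt_top_of_enorm_le (h := f.toFun) (K := ‖((s : ℂ) - t)⁻¹‖ₑ) hq (by finiteness)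
    (addSMul g f s).differentiableOn.continuousOn (fun z _ => ?_) (lt_top_iff_ne_top.2 hs)
    (lt_top_iff_ne_top.2 ht)).ne hf
  have e : f.toFun z = ((s : ℂ) - t)⁻¹ *
      ((addSMul g f s).toFun z - (addSMul g f t).toFun z) := by
    simp only [addSMul, Pi.add_apply]
    field_simp
    ring
  conv_lhs => rw [e]
  rw [enorm_mul]
  gcongr
  exact enorm_sub_le

/-- If one function is nowhere better than `H^p`, then such functions are dense. -/
theorem dense_nowhereBetter_of_mem {f : HardySpace p} (hf : f ∈ nowhereBetter p) :
    Dense (nowhereBetter p) := by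
  intro g
  rw [nowhereBetter_eq_iInter, Set.mem_iInter] at hf
  -- The exceptional parameters: at most one for each of countably many conditions, so `0` is a
  -- limit of parameters outside `B`.
  set B : Set ℝ := ⋃ i : ℕ × {x : ℚ × ℚ // x.1 < x.2},
    {s : ℝ | arcSup (addSMul g f s).toFun (p + 1 / (i.1 + 1)) i.2.1.1 i.2.1.2 ≠ ∞} with hB
  have hcount : B.Countable := Set.countable_iUnion fun i =>
    (subsingleton_addSMul_arcSup_lt_top g f (by have := hp.out; positivity) (hf i)).countable
  have hgood : ∀ s ∈ Bᶜ, addSMul g f s ∈ nowhereBetter p := by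
    intro s hs
    rw [nowhereBetter_eq_iInter]
    simpa [hB] using hs
  refine mem_closure_iff_frequently.2 ((tendsto_addSMul g f).frequently ?_)
  exact (mem_closure_iff_frequently.1 (hcount.dense_compl ℝ 0)).mono hgood

end HardySpace

/-! ### Singular powers and their `L^1` means. -/

/-- In the right half-plane `|arg z| < π/2`, so `z^{-β}` stays in the sector of half-angle `βπ/2`.
-/
theorem Complex.norm_rpow_neg_le_re_cpow {z : ℂ} (hz : 0 < z.re) {β : ℝ} (h0 : 0 ≤ β)
    (h1 : β ≤ 1) :
    Real.cos (Real.pi / 2 * β) * ‖z‖ ^ (-β) ≤ (z ^ ((-β : ℝ) : ℂ)).re := by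
  rw [Complex.cpow_ofReal_re, mul_comm]
  gcongr
  have h2 : |z.arg| ≤ Real.pi / 2 := (Complex.abs_arg_lt_pi_div_two_iff.2 (Or.inl hz)).le
  rw [← Real.cos_abs (z.arg * -β), abs_mul, abs_neg, abs_of_nonneg h0]
  refine Real.cos_le_cos_of_nonneg_of_le_pi (by positivity) ?_ (by gcongr)
  nlinarith [Real.pi_pos]

/-- The function `(1 - e^{-it} z)^{-β}`, which is singular at `e^{it}`. -/
noncomputable def singularPower (t β : ℝ) (z : ℂ) : ℂ :=
  (1 - Complex.exp (-(t * Complex.I)) * z) ^ ((-β : ℝ) : ℂ)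

theorem norm_exp_neg_mul_I_mul (t : ℝ) (z : ℂ) :
    ‖Complex.exp (-(t * Complex.I)) * z‖ = ‖z‖ := by
  have e : -(t * Complex.I : ℂ) = ((-t : ℝ) : ℂ) * Complex.I := by push_cast; ring
  rw [norm_mul, e, Complex.norm_exp_ofReal_mul_I, one_mul]

theorem re_one_sub_exp_mul_pos (t : ℝ) {z : ℂ} (hz : z ∈ Metric.ball (0 : ℂ) 1) :
    0 < (1 - Complex.exp (-(t * Complex.I)) * z).re := by
  have h1 := Complex.re_le_norm (Complex.exp (-(t * Complex.I)) * z)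
  rw [norm_exp_neg_mul_I_mul] at h1
  have h2 : ‖z‖ < 1 := by simpa using hz
  simp only [Complex.sub_re, Complex.one_re]
  linarith

theorem differentiableOn_singularPower (t β : ℝ) :
    DifferentiableOn ℂ (singularPower t β) (Metric.ball 0 1) := by
  unfold singularPower
  refine DifferentiableOn.cpow_const (by fun_prop) fun z hz => ?_
  exact Or.inl (re_one_sub_exp_mul_pos t hz)

theorem norm_singularPower (t β : ℝ) (z : ℂ) :
    ‖singularPower t β z‖ = ‖1 - Complex.exp (-(t * Complex.I)) * z‖ ^ (-β) :=
  Complex.norm_cpow_real _ _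

theorem norm_singularPower_le (t : ℝ) {β : ℝ} (h0 : 0 ≤ β) (h1 : β ≤ 1) {z : ℂ} {R : ℝ}
    (hR : R < 1) (hz : ‖z‖ ≤ R) : ‖singularPower t β z‖ ≤ (1 - R)⁻¹ := by
  rw [norm_singularPower]
  have hR0 : 0 ≤ R := (norm_nonneg z).trans hz
  have h2 : 1 - R ≤ ‖1 - Complex.exp (-(t * Complex.I)) * z‖ := by
    have := norm_sub_norm_le 1 (Complex.exp (-(t * Complex.I)) * z)
    rw [norm_one, norm_exp_neg_mul_I_mul] at this
    linarith
  have h3 : 0 < 1 - R := by linarith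
  calc ‖1 - Complex.exp (-(t * Complex.I)) * z‖ ^ (-β) ≤ (1 - R) ^ (-β) :=
        Real.rpow_le_rpow_of_nonpos h3 h2 (by linarith)
    _ ≤ (1 - R) ^ (-1 : ℝ) := Real.rpow_le_rpow_of_exponent_ge h3 (by linarith) (by linarith)
    _ = (1 - R)⁻¹ := Real.rpow_neg_one _

theorem cos_mul_norm_singularPower_le_re (t : ℝ) {β : ℝ} (h0 : 0 ≤ β) (h1 : β ≤ 1) {z : ℂ}
    (hz : z ∈ Metric.ball (0 : ℂ) 1) :
    Real.cos (Real.pi / 2 * β) * ‖singularPower t β z‖ ≤ (singularPower t β z).re := by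
  rw [norm_singularPower]
  exact Complex.norm_rpow_neg_le_re_cpow (re_one_sub_exp_mul_pos t hz) h0 h1

theorem cos_pi_div_two_mul_pos {β : ℝ} (h0 : 0 ≤ β) (h1 : β < 1) :
    0 < Real.cos (Real.pi / 2 * β) := by
  have := Real.pi_pos
  exact Real.cos_pos_of_mem_Ioo ⟨by nlinarith, by nlinarith⟩

theorem integral_circle_eq {f : ℂ → ℂ} (hf : DifferentiableOn ℂ f (Metric.ball 0 1)) {r : ℝ}
    (hr : r ∈ Set.Ioo (0 : ℝ) 1) :
    ∫ θ in (0 : ℝ)..2 * Real.pi, f (r * Complex.exp (θ * Complex.I)) = 2 * Real.pi * f 0 := by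
  have hsub : closure (Metric.ball (0 : ℂ) |r|) ⊆ Metric.ball 0 1 := by
    rw [abs_of_pos hr.1]
    exact Metric.closure_ball_subset_closedBall.trans (Metric.closedBall_subset_ball hr.2)
  have h := (hf.mono hsub).diffContOnCl.circleAverage
  rw [Real.circleAverage_def] at h
  simp only [circleMap, zero_add, Complex.real_smul] at h
  rw [← h]
  push_cast
  rw [mul_inv_cancel_left₀ (by simp)]

/-- The modulus is at most `c⁻¹` times the real part, whose integral is `2π` by the mean value
property, the value at `0` being `1`. The bound is thus uniform in `r`. -/
theorem arcIntegral_singularPower_le (t : ℝ) {β : ℝ} (h0 : 0 ≤ β) (h1 : β < 1) {r : ℝ}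
    (hr : r ∈ Set.Ioo (0 : ℝ) 1) :
    arcIntegral (singularPower t β) 1 0 (2 * Real.pi) r ≤
      ENNReal.ofReal (2 * Real.pi * (Real.cos (Real.pi / 2 * β))⁻¹) := by
  have hc := cos_pi_div_two_mul_pos h0 h1
  set c := Real.cos (Real.pi / 2 * β)
  have hd := differentiableOn_singularPower t β
  have hcont := continuous_circle hd.continuousOn hr
  have hp := Real.two_pi_pos
  have hre : ∫ θ in (0 : ℝ)..2 * Real.pi,
      (singularPower t β (r * Complex.exp (θ * Complex.I))).re = 2 * Real.pi := by
    have h2 := Complex.reCLM.intervalIntegral_comp_comm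
      (hcont.intervalIntegrable (μ := MeasureTheory.volume) 0 (2 * Real.pi))
    simp only [Complex.reCLM_apply] at h2
    rw [h2, integral_circle_eq hd hr]
    simp [singularPower]
  calc arcIntegral (singularPower t β) 1 0 (2 * Real.pi) r
      ≤ ∫⁻ θ in Set.Icc 0 (2 * Real.pi),
          ENNReal.ofReal (c⁻¹ * (singularPower t β (r * Complex.exp (θ * Complex.I))).re) := by
        refine MeasureTheory.lintegral_mono fun θ => ?_
        rw [ENNReal.rpow_one, ← ofReal_norm]
        refine ENNReal.ofReal_le_ofReal ?_
        rw [inv_mul_eq_div, le_div_iff₀ hc, mul_comm]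
        exact cos_mul_norm_singularPower_le_re t h0 h1.le (circle_mem_ball hr θ)
    _ = ENNReal.ofReal (∫ θ in Set.Icc 0 (2 * Real.pi),
          c⁻¹ * (singularPower t β (r * Complex.exp (θ * Complex.I))).re) := by
        refine (MeasureTheory.ofReal_integral_eq_lintegral_ofReal ?_ ?_).symm
        · exact (continuous_const.mul (Complex.continuous_re.comp hcont)).continuousOn.integrableOn_Icc
        · refine Filter.Eventually.of_forall fun θ => ?_
          have h3 := cos_mul_norm_singularPower_le_re t h0 h1.le (circle_mem_ball hr θ)
          have h4 : 0 ≤ c * ‖singularPower t β (r * Complex.exp (θ * Complex.I))‖ := by positivity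
          exact mul_nonneg (by positivity) (h4.trans h3)
    _ = ENNReal.ofReal (2 * Real.pi * c⁻¹) := by
        rw [MeasureTheory.integral_Icc_eq_integral_Ioc, ← intervalIntegral.integral_of_le hp.le,
          intervalIntegral.integral_const_mul, hre, mul_comm]

/-! ### Divergence of the means near a singularity. -/

theorem lintegral_rpow_neg_sub_eq_top {t b γ : ℝ} (hb : t < b) (hγ : 1 ≤ γ) :
    ∫⁻ θ in Set.Ioo t b, ENNReal.ofReal ((θ - t) ^ (-γ)) = ∞ := by
  by_contra hne
  have h0 : 0 < b - t := sub_pos.2 hb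
  have hni := mt (intervalIntegral.integrableOn_Ioo_rpow_iff (s := -γ) h0).1 (by linarith)
  have hpre : (fun θ : ℝ => θ - t) ⁻¹' Set.Ioo 0 (b - t) = Set.Ioo t b := by
    ext x
    simp
  have h1 := (MeasureTheory.measurePreserving_sub_right MeasureTheory.volume
    t).setLIntegral_comp_preimage (s := Set.Ioo 0 (b - t)) measurableSet_Ioo
    (f := fun x => ENNReal.ofReal (x ^ (-γ))) (by fun_prop)
  rw [hpre] at h1
  rw [h1] at hne
  refine hni ⟨(by fun_prop : Measurable fun x : ℝ => x ^ (-γ)).aestronglyMeasurable, ?_⟩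
  rw [MeasureTheory.hasFiniteIntegral_iff_ofReal]
  · exact lt_top_iff_ne_top.2 hne
  · filter_upwards [MeasureTheory.ae_restrict_mem measurableSet_Ioo] with x hx
    exact Real.rpow_nonneg hx.1.le _

/-- A function that dominates a power `|1 - e^{-it} z|^{-γ / q}` with `γ ≥ 1` has unbounded
`q`-means on every arc to the right of `t`. -/
theorem arcSup_eq_top_of_le_norm {f : ℂ → ℂ} (hf : ContinuousOn f (Metric.ball 0 1))
    {t a b q γ K : ℝ} (hq : 0 ≤ q) (hγ : 1 ≤ γ) (hK : 0 < K) (ha : a ≤ t) (hb : t < b)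
    (hle : ∀ z ∈ Metric.ball (0 : ℂ) 1,
      K * ‖1 - Complex.exp (-(t * Complex.I)) * z‖ ^ (-γ) ≤ ‖f z‖ ^ q) :
    arcSup f q a b = ∞ := by
  -- Radii increasing to `1`; the shift by `2` keeps the radius positive at `n = 0`.
  set ρ : ℕ → ℝ := fun n => 1 - 1 / ((n : ℝ) + 2) with hρ
  have hρ1 : ∀ n, ρ n ∈ Set.Ioo (0 : ℝ) 1 := fun n => by
    have h2 : (0 : ℝ) < (n : ℝ) + 2 := by positivity
    refine ⟨?_, ?_⟩
    · simp only [hρ, sub_pos]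
      rw [div_lt_one h2]
      linarith [(Nat.cast_nonneg n : (0 : ℝ) ≤ n)]
    · simp only [hρ]
      linarith [one_div_pos.2 h2]
  have hρlim : Filter.Tendsto ρ Filter.atTop (nhds 1) := by
    have h1 : Filter.Tendsto (fun n : ℕ => 1 / ((n : ℝ) + 2)) Filter.atTop (nhds 0) := by
      have := (Filter.tendsto_add_atTop_iff_nat (f := fun n : ℕ => 1 / (n : ℝ)) 2).2
        tendsto_one_div_atTop_nhds_zero_nat
      simpa using this
    simpa [hρ] using h1.const_sub 1
  have hpt : ∀ θ ∈ Set.Ioo t b, ENNReal.ofReal K * ENNReal.ofReal ((θ - t) ^ (-γ)) ≤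
      Filter.liminf (fun n => ‖f (ρ n * Complex.exp (θ * Complex.I))‖ₑ ^ q) Filter.atTop := by
    intro θ hθ
    have hpos : 0 < θ - t := sub_pos.2 hθ.1
    have hlim : Filter.Tendsto (fun n => ENNReal.ofReal (K * ((1 - ρ n) + (θ - t)) ^ (-γ)))
        Filter.atTop (nhds (ENNReal.ofReal (K * (θ - t) ^ (-γ)))) := by
      refine ENNReal.tendsto_ofReal (Filter.Tendsto.const_mul K ?_)
      have h1 : Filter.Tendsto (fun n => (1 - ρ n) + (θ - t)) Filter.atTop (nhds (θ - t)) := by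
        simpa using (hρlim.const_sub 1).add_const (θ - t)
      exact h1.rpow_const (Or.inl hpos.ne')
    rw [← ENNReal.ofReal_mul hK.le, ← hlim.liminf_eq]
    refine Filter.liminf_le_liminf (Filter.Eventually.of_forall fun n => ?_)
    have h3 := hle _ (circle_mem_ball (hρ1 n) θ)
    set z : ℂ := ρ n * Complex.exp (θ * Complex.I) with hz
    have hzb := circle_mem_ball (hρ1 n) θ
    rw [← ofReal_norm, ENNReal.ofReal_rpow_of_nonneg (norm_nonneg _) hq]
    refine ENNReal.ofReal_le_ofReal (le_trans ?_ h3)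
    refine mul_le_mul_of_nonneg_left ?_ hK.le
    refine Real.rpow_le_rpow_of_nonpos ?_ ?_ (by linarith)
    · rw [norm_pos_iff]
      intro h0
      have := re_one_sub_exp_mul_pos t hzb
      rw [h0] at this
      simp at this
    · have e : Complex.exp (-(t * Complex.I)) * z =
          ρ n * Complex.exp (Complex.I * (θ - t : ℝ)) := by
        rw [hz, mul_left_comm, ← Complex.exp_add]
        congr 2
        push_cast
        ring
      -- With `s = θ - t`, this splitting gives `|1 - ρ e^{is}| ≤ (1 - ρ) + ρ s`, and the negative
      -- exponent reverses the inequality.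
      have e2 : 1 - Complex.exp (-(t * Complex.I)) * z =
          (1 - ρ n : ℝ) - ρ n * (Complex.exp (Complex.I * (θ - t : ℝ)) - 1) := by
        rw [e]
        push_cast
        ring
      rw [e2]
      refine (norm_sub_le _ _).trans (add_le_add ?_ ?_)
      · rw [Complex.norm_real, Real.norm_of_nonneg (by linarith [(hρ1 n).2])]
      · rw [norm_mul, Complex.norm_real, Real.norm_of_nonneg (hρ1 n).1.le]
        have h5 := Real.norm_exp_I_mul_ofReal_sub_one_le (x := θ - t)
        rw [Real.norm_of_nonneg hpos.le] at h5
        have h6 := norm_nonneg (Complex.exp (Complex.I * (θ - t : ℝ)) - 1)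
        nlinarith [(hρ1 n).2, (hρ1 n).1]
  have htop : ENNReal.ofReal K * ∫⁻ θ in Set.Ioo t b, ENNReal.ofReal ((θ - t) ^ (-γ)) = ∞ := by
    rw [lintegral_rpow_neg_sub_eq_top hb hγ, ENNReal.mul_top]
    simpa using hK
  rw [← top_le_iff, ← htop, ← MeasureTheory.lintegral_const_mul' _ _ ENNReal.ofReal_ne_top]
  calc ∫⁻ θ in Set.Ioo t b, ENNReal.ofReal K * ENNReal.ofReal ((θ - t) ^ (-γ))
      ≤ ∫⁻ θ in Set.Ioo t b, Filter.liminf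
          (fun n => ‖f (ρ n * Complex.exp (θ * Complex.I))‖ₑ ^ q) Filter.atTop :=
        MeasureTheory.setLIntegral_mono' measurableSet_Ioo hpt
    _ ≤ Filter.liminf (fun n => ∫⁻ θ in Set.Ioo t b,
          ‖f (ρ n * Complex.exp (θ * Complex.I))‖ₑ ^ q) Filter.atTop :=
        MeasureTheory.lintegral_liminf_le fun n =>
          (continuous_circle hf (hρ1 n)).enorm.measurable.pow_const q
    _ ≤ arcSup f q a b := by
        refine Filter.liminf_le_of_le (by isBoundedDefault) fun d hd => ?_
        obtain ⟨n, hn⟩ := hd.exists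
        refine hn.trans (le_trans ?_ (arcIntegral_le_arcSup f q a b (hρ1 n)))
        exact MeasureTheory.lintegral_mono_set fun θ hθ => ⟨ha.trans hθ.1.le, hθ.2.le⟩

/-! ### Sums of singular powers. -/

/-- A sum of singular powers `∑ w_i (1 - e^{-i t_i} z)^{-β_i}`. -/
noncomputable def singularSum {ι : Type*} (w t β : ι → ℝ) (z : ℂ) : ℂ :=
  ∑' i, (w i : ℂ) * singularPower (t i) (β i) z

section SingularSum

variable {ι : Type*} {w t β : ι → ℝ}

theorem norm_singularSum_term_le (hw : ∀ i, 0 ≤ w i) (h0 : ∀ i, 0 ≤ β i) (h1 : ∀ i, β i ≤ 1)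
    {z : ℂ} {R : ℝ} (hR : R < 1) (hz : ‖z‖ ≤ R) (i : ι) :
    ‖(w i : ℂ) * singularPower (t i) (β i) z‖ ≤ w i * (1 - R)⁻¹ := by
  rw [norm_mul, Complex.norm_real, Real.norm_of_nonneg (hw i)]
  exact mul_le_mul_of_nonneg_left (norm_singularPower_le _ (h0 i) (h1 i) hR hz) (hw i)

theorem summable_norm_singularSum_term (hw : ∀ i, 0 ≤ w i) (hs : Summable w) (h0 : ∀ i, 0 ≤ β i)
    (h1 : ∀ i, β i ≤ 1) {z : ℂ} (hz : z ∈ Metric.ball (0 : ℂ) 1) :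
    Summable fun i => ‖(w i : ℂ) * singularPower (t i) (β i) z‖ :=
  (hs.mul_right (1 - ‖z‖)⁻¹).of_nonneg_of_le (fun _ => norm_nonneg _)
    (norm_singularSum_term_le hw h0 h1 (by simpa using hz) le_rfl)

theorem differentiableOn_singularSum (hw : ∀ i, 0 ≤ w i) (hs : Summable w) (h0 : ∀ i, 0 ≤ β i)
    (h1 : ∀ i, β i ≤ 1) : DifferentiableOn ℂ (singularSum w t β) (Metric.ball 0 1) := by
  intro z hz
  obtain ⟨R, hzR, hR⟩ := exists_between (show ‖z‖ < 1 by simpa using hz)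
  have hd : DifferentiableOn ℂ (singularSum w t β) (Metric.ball 0 R) := by
    refine Complex.differentiableOn_tsum_of_summable_norm (hs.mul_right (1 - R)⁻¹)
      (fun i => ?_) Metric.isOpen_ball fun i x hx => ?_
    · exact ((differentiableOn_singularPower (t i) (β i)).const_mul _).mono
        (Metric.ball_subset_ball hR.le)
    · exact norm_singularSum_term_le hw h0 h1 hR (by simpa using (Metric.mem_ball.1 hx).le) i
  exact (hd.differentiableAt (Metric.isOpen_ball.mem_nhds
    (by simpa using hzR))).differentiableWithinAt

/-- All terms have nonnegative real part, so the sum cannot cancel any one of them. -/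
theorem le_re_singularSum (hw : ∀ i, 0 ≤ w i) (hs : Summable w) (h0 : ∀ i, 0 ≤ β i)
    (h1 : ∀ i, β i < 1) {z : ℂ} (hz : z ∈ Metric.ball (0 : ℂ) 1) (i : ι) :
    w i * (Real.cos (Real.pi / 2 * β i) * ‖singularPower (t i) (β i) z‖) ≤
      (singularSum w t β z).re := by
  have hterm : ∀ j, w j * (Real.cos (Real.pi / 2 * β j) * ‖singularPower (t j) (β j) z‖) ≤
      ((w j : ℂ) * singularPower (t j) (β j) z).re := fun j => by
    rw [Complex.re_ofReal_mul]
    exact mul_le_mul_of_nonneg_left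
      (cos_mul_norm_singularPower_le_re _ (h0 j) (h1 j).le hz) (hw j)
  have hsum := (summable_norm_singularSum_term (t := t) hw hs h0 (fun i => (h1 i).le) hz).of_norm
  rw [singularSum, Complex.re_tsum hsum]
  refine (hterm i).trans ((Complex.reCLM.summable hsum).le_tsum i fun j _ => ?_)
  exact le_trans (mul_nonneg (hw j) (mul_nonneg (cos_pi_div_two_mul_pos (h0 j) (h1 j)).le
    (norm_nonneg _))) (hterm j)

theorem arcSup_singularSum_lt_top [Countable ι] (hw : ∀ i, 0 ≤ w i)
    (h0 : ∀ i, 0 ≤ β i) (h1 : ∀ i, β i < 1)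
    (hsc : Summable fun i => w i * (Real.cos (Real.pi / 2 * β i))⁻¹) :
    arcSup (singularSum w t β) 1 0 (2 * Real.pi) < ∞ := by
  have hpos : ∀ i, 0 ≤ w i * (2 * Real.pi * (Real.cos (Real.pi / 2 * β i))⁻¹) := fun i =>
    mul_nonneg (hw i) (mul_nonneg Real.two_pi_pos.le
      (inv_nonneg.2 (cos_pi_div_two_mul_pos (h0 i) (h1 i)).le))
  refine lt_of_le_of_lt (b := ∑' i, ENNReal.ofReal
    (w i * (2 * Real.pi * (Real.cos (Real.pi / 2 * β i))⁻¹))) (iSup₂_le fun r hr => ?_) ?_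
  · have hm : ∀ i, Measurable fun θ : ℝ =>
        ‖(w i : ℂ) * singularPower (t i) (β i) (r * Complex.exp (θ * Complex.I))‖ₑ := fun i =>
      (continuous_const.mul (continuous_circle
        (differentiableOn_singularPower (t i) (β i)).continuousOn hr)).enorm.measurable
    calc arcIntegral (singularSum w t β) 1 0 (2 * Real.pi) r
        ≤ ∫⁻ θ in Set.Icc 0 (2 * Real.pi), ∑' i,
            ‖(w i : ℂ) * singularPower (t i) (β i) (r * Complex.exp (θ * Complex.I))‖ₑ := by
          refine MeasureTheory.lintegral_mono fun θ => ?_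
          rw [ENNReal.rpow_one]
          exact enorm_tsum_le_tsum_enorm
      _ = ∑' i, ∫⁻ θ in Set.Icc 0 (2 * Real.pi),
            ‖(w i : ℂ) * singularPower (t i) (β i) (r * Complex.exp (θ * Complex.I))‖ₑ :=
          MeasureTheory.lintegral_tsum fun i => (hm i).aemeasurable
      _ ≤ _ := by
          refine ENNReal.tsum_le_tsum fun i => ?_
          have hI := arcIntegral_singularPower_le (t i) (h0 i) (h1 i) hr
          simp only [arcIntegral, ENNReal.rpow_one] at hI
          simp only [enorm_mul]
          rw [MeasureTheory.lintegral_const_mul' _ _ (by finiteness), ENNReal.ofReal_mul (hw i)]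
          refine mul_le_mul' (le_of_eq ?_) hI
          rw [← ofReal_norm, Complex.norm_real, Real.norm_of_nonneg (hw i)]
  · rw [← ENNReal.ofReal_tsum_of_nonneg hpos]
    · exact ENNReal.ofReal_lt_top
    · refine (hsc.mul_left (2 * Real.pi)).congr fun i => by ring

end SingularSum

/-- Positive weights that make a countable family of positive numbers summable. -/
theorem exists_pos_summable_mul {ι : Type*} [Countable ι] (M : ι → ℝ) (hM : ∀ i, 0 < M i) :
    ∃ w : ι → ℝ, (∀ i, 0 < w i) ∧ Summable w ∧ Summable fun i => w i * M i := by
  obtain ⟨ε, hε, c, hc, -⟩ := NNReal.exists_pos_sum_of_countable one_ne_zero ι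
  have hs : Summable fun i => (ε i : ℝ) := NNReal.summable_coe.2 hc.summable
  have hp : ∀ i, 0 < (ε i : ℝ) := fun i => by exact_mod_cast hε i
  -- Dividing by `1 + M i` makes both `w i` and `w i * M i` at most `ε i`.
  refine ⟨fun i => ε i / (1 + M i), fun i => div_pos (hp i) (by linarith [hM i]),
    hs.of_nonneg_of_le (fun i => ?_) (fun i => ?_), hs.of_nonneg_of_le (fun i => ?_) (fun i => ?_)⟩
  · exact div_nonneg (hp i).le (by linarith [hM i])
  · exact div_le_self (hp i).le (by linarith [hM i])
  · exact mul_nonneg (div_nonneg (hp i).le (by linarith [hM i])) (hM i).le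
  · rw [div_mul_eq_mul_div, div_le_iff₀ (by linarith [hM i])]
    nlinarith [hp i, hM i]

/-! ### A function that is nowhere better than `H^p`. -/

theorem HardySpace.nonempty_nowhereBetter {p : ℝ} (hp : 0 < p) :
    (HardySpace.nowhereBetter p).Nonempty := by
  let t : ℚ × ℕ → ℝ := fun i => i.1
  let β : ℚ × ℕ → ℝ := fun i => 1 - 1 / ((i.2 : ℝ) + 1)
  have hβ0 : ∀ i, 0 ≤ β i := fun i => by
    have h : (1 : ℝ) ≤ (i.2 : ℝ) + 1 := by simp
    exact sub_nonneg.2 ((div_le_one (by linarith)).2 h)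
  have hβ1 : ∀ i, β i < 1 := fun i => sub_lt_self _ (by positivity)
  -- The constants `(cos (πβ/2))⁻¹` blow up as `β → 1`; the weights absorb them.
  obtain ⟨w, hw, hs, hsc⟩ := exists_pos_summable_mul
    (fun i => (Real.cos (Real.pi / 2 * β i))⁻¹)
    fun i => inv_pos.2 (cos_pi_div_two_mul_pos (hβ0 i) (hβ1 i))
  have hw0 : ∀ i, 0 ≤ w i := fun i => (hw i).le
  let F := singularSum w t β
  have hle : ∀ z ∈ Metric.ball (0 : ℂ) 1, ∀ i,
      w i * (Real.cos (Real.pi / 2 * β i) * ‖singularPower (t i) (β i) z‖) ≤ (F z).re :=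
    fun z hz i => le_re_singularSum hw0 hs hβ0 hβ1 hz i
  have hre : ∀ z ∈ Metric.ball (0 : ℂ) 1, 0 < (F z).re := by
    intro z hz
    refine lt_of_lt_of_le ?_ (hle z hz (0, 0))
    have hn : 0 < ‖singularPower (t (0, 0)) (β (0, 0)) z‖ := by
      rw [norm_singularPower]
      refine Real.rpow_pos_of_pos ((re_one_sub_exp_mul_pos _ hz).trans_le
        (Complex.re_le_norm _)) _
    exact mul_pos (hw _) (mul_pos (cos_pi_div_two_mul_pos (hβ0 _) (hβ1 _)) hn)
  -- Since `Re F > 0`, the principal power is holomorphic on the disc; the indicator gives the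
  -- extension by zero that `HardySpace` requires.
  let f : ℂ → ℂ := (Metric.ball (0 : ℂ) 1).indicator fun z => F z ^ ((1 / p : ℝ) : ℂ)
  have hnorm : ∀ z ∈ Metric.ball (0 : ℂ) 1, ‖f z‖ = ‖F z‖ ^ (1 / p) := fun z hz => by
    simp only [f, Set.indicator_of_mem hz, Complex.norm_cpow_real]
  have hFd : DifferentiableOn ℂ F (Metric.ball 0 1) :=
    differentiableOn_singularSum hw0 hs hβ0 fun i => (hβ1 i).le
  have hd : DifferentiableOn ℂ f (Metric.ball 0 1) :=
    (hFd.cpow_const (c := ((1 / p : ℝ) : ℂ)) fun z hz => Or.inl (hre z hz)).congr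
      fun z hz => Set.indicator_of_mem hz _
  have hfin : arcSup f p 0 (2 * Real.pi) < ∞ := by
    refine lt_of_le_of_lt (iSup₂_mono fun r hr => ?_)
      (arcSup_singularSum_lt_top (t := t) hw0 hβ0 hβ1 hsc)
    refine MeasureTheory.lintegral_mono fun θ => ?_
    have hz := circle_mem_ball hr θ
    rw [ENNReal.rpow_one, ← ofReal_norm, ← ofReal_norm,
      ENNReal.ofReal_rpow_of_nonneg (norm_nonneg _) hp.le, hnorm _ hz,
      ← Real.rpow_mul (norm_nonneg _), one_div_mul_cancel hp.ne', Real.rpow_one]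
  refine ⟨⟨f, hd, hfin, fun z hz => Set.indicator_of_notMem hz _⟩, fun q hq a b hab hmem => ?_⟩
  obtain ⟨x, hax, hxb⟩ := exists_rat_btwn hab
  have hq0 : 0 < q := hp.trans hq
  have hpq : 0 < 1 - p / q := sub_pos.2 ((div_lt_one hq0).2 hq)
  -- This choice makes `β (x, n) > p / q`, so the singularity of `|f|^q` at `x` has order at least
  -- `1`.
  obtain ⟨n, hn⟩ := exists_nat_one_div_lt hpq
  have hγ : 1 ≤ β (x, n) * (q / p) := by
    have h1 : p / q ≤ β (x, n) := by simp only [β]; linarith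
    rw [div_le_iff₀ hq0] at h1
    rwa [← mul_div_assoc, one_le_div hp]
  have hc := cos_pi_div_two_mul_pos (hβ0 (x, n)) (hβ1 (x, n))
  set c := Real.cos (Real.pi / 2 * β (x, n))
  have hwc : 0 < w (x, n) * c := mul_pos (hw _) hc
  refine hmem.2.ne (arcSup_eq_top_of_le_norm (K := (w (x, n) * c) ^ (q / p)) hd.continuousOn
    hq0.le hγ (Real.rpow_pos_of_pos hwc _) hax.le hxb fun z hz => ?_)
  have h2 := (hle z hz (x, n)).trans (Complex.re_le_norm _)
  rw [norm_singularPower, ← mul_assoc] at h2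
  have h3 := Real.rpow_le_rpow (by positivity) h2 (by positivity : 0 ≤ q / p)
  rw [Real.mul_rpow hwc.le (by positivity), ← Real.rpow_mul (norm_nonneg _), neg_mul] at h3
  rw [hnorm z hz, ← Real.rpow_mul (norm_nonneg _), one_div_mul_eq_div]
  exact h3

theorem theorem8 (p : ℝ) [hp : Fact (0 < p)] :
    HardySpace.nowhereBetter p =
        {f : HardySpace p | ∀ q : ℝ, p < q → ∀ a b : ℝ, a < b →
          (⨆ r ∈ Set.Ioo (0 : ℝ) 1,
            (∫⁻ θ in Set.Icc a b, ‖f.toFun (r * Complex.exp (θ * Complex.I))‖ₑ ^ q)) = ⊤} ∧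
      IsGδ (HardySpace.nowhereBetter p) ∧
      Dense (HardySpace.nowhereBetter p) ∧
      (HardySpace.nowhereBetter p).Nonempty := by
  have hne := HardySpace.nonempty_nowhereBetter hp.out
  refine ⟨?_, HardySpace.isGδ_nowhereBetter,
    hne.elim fun f hf => HardySpace.dense_nowhereBetter_of_mem hf, hne⟩
  ext f
  simp only [HardySpace.nowhereBetter, HardySpace.notMem_localizedHardy_iff, arcSup, arcIntegral]
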